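/- \textbf{The model.} A \emph{configuration} $C$ is a finite set of positions (\emph{nodes}) of $\mathbf Z^2$ together with one distinguished node $v_{\rm gen}\in C$, the \emph{general}. The \emph{boundary condition} of $v\in C$ is the vector in $\{0,1\}^4$ telling which of the positions $v+(1,0)$, $v+(0,1)$, $v+(-1,0)$, $v+(0,-1)$ belong to $C$. A \emph{finite automaton} $A$ has a finite set of states and four inputs, from the east, north, west and south. When a copy of $A$ is placed at every node of $C$, all copies work synchronously: the state of a node at time $t+1$ is given by the transition function of $A$ from its own state at time $t$ and its four inputs at time $t$, an input being the state of the neighbour in that direction, or the symbol $\#$ if that position is not in $C$. There is a \emph{quiescent} state $\mathrm Q$ such that a node in $\mathrm Q$ all of whose inputs are $\mathrm Q$ or $\#$ stays in $\mathrm Q$. At time $0$ the general is in a general state and all other nodes are in $\mathrm Q$. In the \emph{traditional model} there are one general state $\mathrm G$ and one firing state $\mathrm F$, and $\mathrm Q,\mathrm G,\mathrm F$ are different; put $\mathcal F=\{\mathrm F\}$. In the \emph{boundary sensitive model} the general state (always different from $\mathrm Q$) used at time $0$ may depend on the boundary condition of $v_{\rm gen}$ in $C$, and there is a set $\mathcal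 F$ of firing states with $\mathrm Q\notin\mathcal F$, which may contain general states. \textbf{Minimal-time solutions.} A \emph{variation} $\Gamma$ is a set of configurations. An automaton $A$ is a \emph{solution} of $\Gamma$ if for every $C\in\Gamma$ there is a time ${\rm ft}(C,A)$ at which every node of $C$ is in a state of $\mathcal F$, no node having been in such a state before. For $C \in \Gamma$ put ${\rm mft}_\Gamma(C)=\min\{{\rm ft}(C,A)\mid A\text{ is a solution of }\Gamma\}$. A \emph{minimal-time solution} of $\Gamma$ is a solution $\tilde A$ of $\Gamma$ with ${\rm ft}(C,\tilde A)={\rm mft}_\Gamma(C)$ for all $C\in\Gamma$. \textbf{The variations.} Let $C_{\rm RW}(w,h)$ be the rectangular wall consisting of the integer points on the boundary of the rectangle $[0,w]\times[0,h]$. For integers $a,b\ge 1$, the configurations of $\text{RECT-WALL}[a,b]$ are all $C_{\rm RW}(al,bl)$ with an integer $l\ge 2$ and with the general at the southwest corner $(0,0)$; the configurations of $\text{g-RECT-WALL}[a,b]$ are all $C_{\rm RW}(al,bl)$ with $l\ge2$ and with the general at an arbitrary node. \textbf{Theorem.} For all integers $a,b\ge 1$ (including the case $a=b$ of square walls), and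 in both the traditional and the boundary sensitive model, neither $\text{RECT-WALL}[a,b]$ nor $\text{g-RECT-WALL}[a,b]$ has a minimal-time solution. -/

import Mathlib

namespace FSSP

/-- The four directions east, north, west, south in the two-dimensional grid `ℤ × ℤ`. -/
def dir : Fin 4 → ℤ × ℤ := ![(1, 0), (0, 1), (-1, 0), (0, -1)]

/-- A configuration: a finite set of positions (nodes) of the grid, one of which is
the position of the general. -/
structure Config where
  cells : Finset (ℤ × ℤ)
  gen : ℤ × ℤ
  gen_mem : gen ∈ cells

/-- The boundary condition of the position `v`: for each direction, whether there is a node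
next to `v` in that direction. -/
def Config.bc (C : Config) (v : ℤ × ℤ) : Fin 4 → Bool :=
  fun d => decide (v + dir d ∈ C.cells)

/-- A finite automaton with inputs from the east, the north, the west and the south. An input is
`some s` (the neighbour in that direction is in the state `s`) or `none` (the signal `#`: there is
no neighbour in that direction).

This is the general form, used in the boundary sensitive model: the general states
`gen b` may depend on the boundary condition `b` of the general, and `firing` is the set of
firing states, which may contain general states but not the quiescent state. -/
structure Automaton where
  State : Type
  finite_state : Finite State
  quiescent : State
  gen : (Fin 4 → Bool) → State
  firing : Set State
  next : State → (Fin 4 → Option State) → State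
  gen_ne_quiescent : ∀ b, gen b ≠ quiescent
  quiescent_notMem_firing : quiescent ∉ firing
  next_quiescent : ∀ inp : Fin 4 → Option State,
    (∀ d, inp d = some quiescent ∨ inp d = none) → next quiescent inp = quiescent

/-- The two models of the firing squad synchronization problem. -/
inductive Model where
  | traditional
  | boundarySensitive

/-- The automata of each model. In the traditional model there is one general state `G`, there is
one firing state `F`, and `Q`, `G`, `F` are different (that `Q` is different from `G` and `F` holds
for every `Automaton`). -/
def Automaton.InModel (A : Automaton) : Model → Prop
  | .traditional => ∃ G F : A.State, G ≠ F ∧ (∀ b, A.gen b = G) ∧ A.firing = {F}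
  | .boundarySensitive => True

/-- `A.st C t v` is the state at time `t` of the node `v` of `C` when all nodes of `C` are copies
of `A`. (The value at a position outside `C` has no meaning and is never used as an input.) -/
def Automaton.st (A : Automaton) (C : Config) : ℕ → ℤ × ℤ → A.State
  | 0, v => if v = C.gen then A.gen (C.bc v) else A.quiescent
  | t + 1, v => A.next (A.st C t v)
      (fun d => if v + dir d ∈ C.cells then some (A.st C t (v + dir d)) else none)

/-- All nodes of `C` enter a firing state at time `T`, each of them for the first time. -/
def Automaton.FiresAt (A : Automaton) (C : Config) (T : ℕ) : Prop :=
  ∀ v ∈ C.cells, (∀ t < T, A.st C t v ∉ A.firing) ∧ A.st C T v ∈ A.firing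

/-- The firing time of `A` for `C`; meaningful if `A` fires `C` at some time, and then it is the
unique time at which `A` fires `C` (see `ft_eq`). -/
noncomputable def Automaton.ft (A : Automaton) (C : Config) : ℕ :=
  sInf {T | A.FiresAt C T}

theorem Automaton.FiresAt.ft_eq {A : Automaton} {C : Config} {T : ℕ} (h : A.FiresAt C T) :
    A.ft C = T := by
  have h' : A.FiresAt C (A.ft C) := Nat.sInf_mem (s := {T | A.FiresAt C T}) ⟨T, h⟩
  rcases lt_trichotomy (A.ft C) T with hlt | heq | hgt
  · exact absurd (h' _ C.gen_mem).2 ((h _ C.gen_mem).1 _ hlt)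
  · exact heq
  · exact absurd (h _ C.gen_mem).2 ((h' _ C.gen_mem).1 _ hgt)

/-- A solution, in the model `m`, of the variation whose configurations are the elements
of `Γ`. -/
def IsSolution (m : Model) (Γ : Set Config) (A : Automaton) : Prop :=
  A.InModel m ∧ ∀ C ∈ Γ, ∃ T, A.FiresAt C T

/-- The minimum firing time of `C` (a minimum over a nonempty set as soon as the variation has a
solution). -/
noncomputable def mft (m : Model) (Γ : Set Config) (C : Config) : ℕ :=
  sInf {T | ∃ A : Automaton, IsSolution m Γ A ∧ A.ft C = T}

/-- A minimal-time solution: a solution that fires every configuration at its minimum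
firing time. -/
def IsMinimalTimeSolution (m : Model) (Γ : Set Config) (A : Automaton) : Prop :=
  IsSolution m Γ A ∧ ∀ C ∈ Γ, A.ft C = mft m Γ C

/-- The rectangular wall with horizontal side `w` and vertical side `h` and with its southwest
corner at `(0, 0)`: the positions on the boundary of `[0, w] × [0, h]`. -/
noncomputable def rectWallCells (w h : ℕ) : Finset (ℤ × ℤ) :=
  (Finset.Icc (0 : ℤ) w ×ˢ Finset.Icc (0 : ℤ) h).filter
    (fun p => p.1 = 0 ∨ p.1 = w ∨ p.2 = 0 ∨ p.2 = h)

/-- The variation `RECT-WALL[a, b]`: the walls with sides `a * l`, `b * l`, `l ≥ 2`, with the general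
at the southwest corner. -/
def rectWall (a b : ℕ) : Set Config :=
  {C | ∃ l : ℕ, 2 ≤ l ∧ C.cells = rectWallCells (a * l) (b * l) ∧ C.gen = (0, 0)}

/-- The variation `g-RECT-WALL[a, b]`: the same walls, with the general at any position. -/
def gRectWall (a b : ℕ) : Set Config :=
  {C | ∃ l : ℕ, 2 ≤ l ∧ C.cells = rectWallCells (a * l) (b * l)}

end FSSP

namespace FSSP

/-! ### Running two automata side by side -/

/-! Suppose `A` is a minimal-time solution with `s` states. Take the wall with sides `w = a * l`, `h
= b * l`, where `l = s ^ 2 + 2`, and with the general at the southwest corner. The far corner is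
first reached at time `w + h`, so nothing fires earlier (`le_of_firesAt_wall`).

`A` cannot fire at `w + h` (`not_firesAt_wall`): the wave front climbing the east side meets only
quiescent nodes, so the states of a node on being reached and one step later determine the same pair
for the next node. By pigeonhole these pairs repeat, and the firing of the node below the far corner
would already have occurred at a lower node, too early.

Yet some solution does fire at `w + h`. A finite automaton tailored to this one wall
(`Config.detector`) lets every node track which events of the wall agree with what it has seen. Run
alongside `A`, it gives a solution unless another configuration deceives some node
(`exists_solution_ft_eq`). None does: by time `w + h` each node has learned one side
(`side_eq_of_fits`), and the fixed ratio gives the other. So the minimum firing time is `w + h`,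
which `A` misses. -/

open Classical in
/-- Runs `A` and `D` in parallel and fires as soon as one of them does. -/
noncomputable def Automaton.join (A D : Automaton) : Automaton where
  State := Option (A.State × D.State)
  finite_state := by
    have := A.finite_state
    have := D.finite_state
    infer_instance
  quiescent := some (A.quiescent, D.quiescent)
  gen b := some (A.gen b, D.gen b)
  firing := {none}
  -- The default in `getD` is harmless: the run is followed only up to the first firing. Only new
  -- states are tested, so a firing state at time 0 goes unnoticed; `join_firesAt` therefore asks
  -- for `0 < T`.
  next s inp := s.bind fun p =>
    let q := A.next p.1 fun d => (inp d).map fun x => (x.getD (A.quiescent, D.quiescent)).1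
    let r := D.next p.2 fun d => (inp d).map fun x => (x.getD (A.quiescent, D.quiescent)).2
    if q ∈ A.firing ∨ r ∈ D.firing then none else some (q, r)
  gen_ne_quiescent b h := A.gen_ne_quiescent b (by simpa using congrArg (Option.map Prod.fst) h)
  quiescent_notMem_firing := by simp
  next_quiescent inp h := by
    have h1 : A.next A.quiescent
        (fun d => (inp d).map fun x => (x.getD (A.quiescent, D.quiescent)).1) = A.quiescent :=
      A.next_quiescent _ fun d => by rcases h d with h | h <;> simp [h]
    have h2 : D.next D.quiescent
        (fun d => (inp d).map fun x => (x.getD (A.quiescent, D.quiescent)).2) = D.quiescent :=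
      D.next_quiescent _ fun d => by rcases h d with h | h <;> simp [h]
    simp [h1, h2, A.quiescent_notMem_firing, D.quiescent_notMem_firing]

theorem Automaton.join_st_succ (A D : Automaton) (C : Config) (t : ℕ)
    (h : ∀ v ∈ C.cells, (A.join D).st C t v = some (A.st C t v, D.st C t v))
    {v : ℤ × ℤ} (hv : v ∈ C.cells) [Decidable (A.st C (t + 1) v ∈ A.firing ∨
      D.st C (t + 1) v ∈ D.firing)] :
    (A.join D).st C (t + 1) v = if A.st C (t + 1) v ∈ A.firing ∨ D.st C (t + 1) v ∈ D.firing
      then none else some (A.st C (t + 1) v, D.st C (t + 1) v) := by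
  have key (d : Fin 4) :
      (if v + dir d ∈ C.cells then some ((A.join D).st C t (v + dir d)) else none) =
      if v + dir d ∈ C.cells then
        some (some (A.st C t (v + dir d), D.st C t (v + dir d))) else none := by
    split_ifs with hd
    · exact congrArg some (h _ hd)
    · rfl
  have e1 : (fun d => ((if v + dir d ∈ C.cells then
        some (some (A.st C t (v + dir d), D.st C t (v + dir d))) else none :
        Option (Option (A.State × D.State))).map
          fun x => (x.getD (A.quiescent, D.quiescent)).1)) =
      fun d => if v + dir d ∈ C.cells then some (A.st C t (v + dir d)) else none := by
    funext d; split_ifs <;> rfl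
  have e2 : (fun d => ((if v + dir d ∈ C.cells then
        some (some (A.st C t (v + dir d), D.st C t (v + dir d))) else none :
        Option (Option (A.State × D.State))).map
          fun x => (x.getD (A.quiescent, D.quiescent)).2)) =
      fun d => if v + dir d ∈ C.cells then some (D.st C t (v + dir d)) else none := by
    funext d; split_ifs <;> rfl
  have e3 : (A.join D).st C (t + 1) v = (A.join D).next (some (A.st C t v, D.st C t v))
      (fun d => if v + dir d ∈ C.cells then
        some (some (A.st C t (v + dir d), D.st C t (v + dir d))) else none) :=
    congrArg₂ (A.join D).next (h v hv) (funext key)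
  rw [e3]
  simp only [Automaton.join, Option.bind_some, e1, e2]
  simp only [Automaton.st]
  congr

theorem Automaton.join_st (A D : Automaton) (C : Config) (t : ℕ)
    (h : ∀ s ≤ t, ∀ v ∈ C.cells, A.st C s v ∉ A.firing ∧ D.st C s v ∉ D.firing) :
    ∀ v ∈ C.cells, (A.join D).st C t v = some (A.st C t v, D.st C t v) := by
  classical
  induction t with
  | zero =>
    intro v _
    simp only [Automaton.st, Automaton.join]
    split_ifs <;> rfl
  | succ t ih =>
    intro v hv
    rw [A.join_st_succ D C t (ih fun s hs => h s (by omega)) hv, if_neg]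
    have := h (t + 1) le_rfl v hv
    tauto

theorem Automaton.join_firesAt {A D : Automaton} {C : Config} {T : ℕ} (hT : 0 < T)
    (h : ∀ t < T, ∀ v ∈ C.cells, A.st C t v ∉ A.firing ∧ D.st C t v ∉ D.firing)
    (hf : ∀ v ∈ C.cells, A.st C T v ∈ A.firing ∨ D.st C T v ∈ D.firing) :
    (A.join D).FiresAt C T := by
  classical
  obtain ⟨T, rfl⟩ : ∃ k, T = k + 1 := ⟨T - 1, by omega⟩
  have hst (t : ℕ) (ht : t < T + 1) := A.join_st D C t fun s hs => h s (by omega)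
  refine fun v hv => ⟨fun t ht => ?_, ?_⟩
  · rw [hst t ht v hv]
    exact Option.some_ne_none _
  · rw [A.join_st_succ D C T (hst T (by omega)) hv, if_pos (hf v hv)]
    exact rfl

/-- A constant general state of `D` keeps the paired one independent of the boundary condition, and
`none` is the only firing state whatever `A.firing` is. -/
theorem Automaton.join_inModel {A D : Automaton} {m : Model} (hA : A.InModel m)
    (hD : ∃ g, ∀ b, D.gen b = g) : (A.join D).InModel m := by
  cases m with
  | boundarySensitive => trivial
  | traditional =>
    obtain ⟨G, F, -, hG, -⟩ := hA
    obtain ⟨g, hg⟩ := hD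
    exact ⟨some (G, g), none, Option.some_ne_none _,
      fun b => congrArg some (congrArg₂ Prod.mk (hG b) (hg b)), rfl⟩

/-! ### Nodes are quiescent until they are reached -/

/-- `r` is a lower bound for the distance to the general, attained along paths inside `C`. -/
structure Config.IsRank (C : Config) (r : ℤ × ℤ → ℤ) : Prop where
  gen : r C.gen = 0
  step : ∀ v ∈ C.cells, ∀ d, v + dir d ∈ C.cells → r v ≤ r (v + dir d) + 1
  pred : ∀ v ∈ C.cells, v ≠ C.gen → ∃ d, v + dir d ∈ C.cells ∧ r (v + dir d) = r v - 1
  nonneg : ∀ v ∈ C.cells, 0 ≤ r v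

theorem Automaton.st_eq_quiescent (A : Automaton) {C : Config} {r : ℤ × ℤ → ℤ}
    (hr : C.IsRank r) (t : ℕ) : ∀ v ∈ C.cells, (t : ℤ) < r v → A.st C t v = A.quiescent := by
  induction t with
  | zero =>
    intro v _ h
    refine if_neg ?_
    rintro rfl
    simp [hr.gen] at h
  | succ t ih =>
    intro v hv h
    push_cast at h
    simp only [Automaton.st]
    rw [ih v hv (by omega)]
    refine A.next_quiescent _ fun d => ?_
    split_ifs with hd
    · exact .inl (by rw [ih _ hd (by have := hr.step v hv d hd; omega)])
    · exact .inr rfl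

/-! ### An automaton that recognizes one configuration -/

/-- The pairs of a node of `C` and a time up to `T`. -/
abbrev Config.Events (C : Config) (T : ℕ) : Type := ↥(C.cells ×ˢ Finset.range (T + 1))

/-- The event of being `v` at time `t` is compatible with a set of events, or with `none`, the
knowledge of a node not yet reached. -/
def Config.Compatible (C : Config) (r : ℤ × ℤ → ℤ) (T : ℕ) :
    Option (Set (C.Events T)) → ℤ × ℤ → ℕ → Prop
  | none, v, t => (t : ℤ) < r v
  | some S, v, t => ∃ h : (v, t) ∈ C.cells ×ˢ Finset.range (T + 1), (⟨(v, t), h⟩ : C.Events T) ∈ S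

open Classical in
/-- The automaton whose states are the sets of events of `C` that are compatible with what a
node has seen. -/
noncomputable def Config.detector (C : Config) (r : ℤ × ℤ → ℤ) (T : ℕ) : Automaton where
  State := Option (Set (C.Events T))
  finite_state := inferInstance
  quiescent := none
  -- Ignoring the boundary condition serves both models; the general learns its surroundings only at
  -- time 1.
  gen _ := some {p | p.1 = (C.gen, 0)}
  firing := {s | s ≠ none ∧ ∃ v, C.Compatible r T s v T}
  next s inp :=
    if s = none ∧ ∀ d, inp d = some none ∨ inp d = none then none else
      some {p | 1 ≤ p.1.2 ∧ C.Compatible r T s p.1.1 (p.1.2 - 1) ∧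
        ∀ d, (inp d = none ∧ p.1.1 + dir d ∉ C.cells) ∨
          ∃ s', inp d = some s' ∧ p.1.1 + dir d ∈ C.cells ∧
            C.Compatible r T s' (p.1.1 + dir d) (p.1.2 - 1)}
  gen_ne_quiescent := by simp
  quiescent_notMem_firing := by simp
  next_quiescent inp h := if_pos ⟨rfl, h⟩

variable {C : Config} {r : ℤ × ℤ → ℤ} {T : ℕ}

/-- On its own configuration the detector never discards the actual event. -/
theorem Config.compatible_detector_st (hr : C.IsRank r) (t : ℕ) (ht : t ≤ T) :
    ∀ v ∈ C.cells, C.Compatible r T ((C.detector r T).st C t v) v t := by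
  induction t with
  | zero =>
    intro v hv
    by_cases h : v = C.gen
    · subst h
      simp [Automaton.st, Config.detector, Config.Compatible, C.gen_mem]
    · obtain ⟨d, hd, h1⟩ := hr.pred v hv h
      have := hr.nonneg _ hd
      simp only [Automaton.st, if_neg h, Config.detector, Config.Compatible]
      push_cast; omega
  | succ t ih =>
    intro v hv
    have ih := ih (by omega)
    simp only [Automaton.st]
    set D := C.detector r T
    by_cases hq : D.st C t v = none ∧ ∀ d,
        (if v + dir d ∈ C.cells then some (D.st C t (v + dir d)) else none) = some none ∨
        (if v + dir d ∈ C.cells then some (D.st C t (v + dir d)) else none) = none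
    · have e : D.next (D.st C t v)
          (fun d => if v + dir d ∈ C.cells then some (D.st C t (v + dir d)) else none) = none :=
        if_pos hq
      rw [e]
      have h1 := ih v hv
      rw [hq.1] at h1
      have h1 : (t : ℤ) < r v := h1
      have hg : v ≠ C.gen := by
        rintro rfl
        rw [hr.gen] at h1
        omega
      obtain ⟨d, hd, h2⟩ := hr.pred v hv hg
      have h3 := ih _ hd
      have h4 := hq.2 d
      simp only [if_pos hd, reduceCtorEq, or_false] at h4
      have h4 : D.st C t (v + dir d) = none := Option.some.inj h4
      rw [h4] at h3
      have h3 : (t : ℤ) < r (v + dir d) := h3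
      change ((t + 1 : ℕ) : ℤ) < r v
      push_cast; omega
    · have e : D.next (D.st C t v)
          (fun d => if v + dir d ∈ C.cells then some (D.st C t (v + dir d)) else none) = _ :=
        if_neg hq
      rw [e]
      refine ⟨by simp [hv]; omega, by simp, by simpa using ih v hv, fun d => ?_⟩
      by_cases hd : v + dir d ∈ C.cells
      · exact .inr ⟨_, if_pos hd, hd, by simpa using ih _ hd⟩
      · exact .inl ⟨if_neg hd, hd⟩

/-- A compatible event is compatible with the local structure, and with the previous knowledge of
the node and of its neighbours. -/
theorem Config.compatible_succ {C' : Config} {v v' : ℤ × ℤ} {t t' : ℕ}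
    (h : C.Compatible r T ((C.detector r T).st C' (t' + 1) v') v t) (hv : r v ≤ t) :
    1 ≤ t ∧ C.Compatible r T ((C.detector r T).st C' t' v') v (t - 1) ∧
      (∀ d, v' + dir d ∈ C'.cells ↔ v + dir d ∈ C.cells) ∧
      ∀ d, v + dir d ∈ C.cells →
        C.Compatible r T ((C.detector r T).st C' t' (v' + dir d)) (v + dir d) (t - 1) := by
  simp only [Automaton.st] at h
  set D := C.detector r T
  by_cases hq : D.st C' t' v' = none ∧ ∀ d,
      (if v' + dir d ∈ C'.cells then some (D.st C' t' (v' + dir d)) else none) = some none ∨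
      (if v' + dir d ∈ C'.cells then some (D.st C' t' (v' + dir d)) else none) = none
  · have e : D.next (D.st C' t' v')
        (fun d => if v' + dir d ∈ C'.cells then some (D.st C' t' (v' + dir d)) else none) = none :=
      if_pos hq
    rw [e] at h
    have h : (t : ℤ) < r v := h
    omega
  · have e : D.next (D.st C' t' v')
        (fun d => if v' + dir d ∈ C'.cells then some (D.st C' t' (v' + dir d)) else none) = _ :=
      if_neg hq
    rw [e] at h
    obtain ⟨_, h1, h2, h3⟩ := h
    refine ⟨h1, h2, fun d => ?_, fun d hd => ?_⟩
    · rcases h3 d with ⟨h4, h5⟩ | ⟨s, h4, h5, -⟩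
      · by_cases hd : v' + dir d ∈ C'.cells
        · simp [if_pos hd] at h4
        · exact iff_of_false hd h5
      · by_cases hd : v' + dir d ∈ C'.cells
        · exact iff_of_true hd h5
        · simp [if_neg hd] at h4
    · rcases h3 d with ⟨h4, h5⟩ | ⟨s, h4, h5, h6⟩
      · exact absurd hd h5
      · by_cases hd : v' + dir d ∈ C'.cells
        · have h4 : D.st C' t' (v' + dir d) = s := Option.some.inj ((if_pos hd).symm.trans h4)
          exact h4 ▸ h6
        · simp [if_neg hd] at h4

/-- A reached node knows the time and its position relative to the general. -/
theorem Config.eq_of_compatible (hr : C.IsRank r) {C' : Config} (t : ℕ) :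
    ∀ (v v' : ℤ × ℤ) (t' : ℕ), v ∈ C.cells →
      C.Compatible r T ((C.detector r T).st C' t' v') v t → r v ≤ t →
      t' = t ∧ v' = v - C.gen + C'.gen := by
  induction t with
  | zero =>
    intro v v' t' hv h hvt
    cases t' with
    | succ t' => exact absurd (Config.compatible_succ h hvt).1 (by simp)
    | zero =>
      simp only [Automaton.st, Config.detector] at h
      split_ifs at h with hg
      · obtain ⟨_, h⟩ := h
        have h : (v, 0) = (C.gen, 0) := h
        simp only [Prod.mk.injEq, and_true] at h
        simp [h, hg]
      · have h : ((0 : ℕ) : ℤ) < r v := h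
        omega
  | succ t ih =>
    intro v v' t' hv h hvt
    cases t' with
    | zero =>
      simp only [Automaton.st, Config.detector] at h
      split_ifs at h with hg
      · obtain ⟨_, h⟩ := h
        have h : (v, t + 1) = (C.gen, 0) := h
        simp at h
      · have h : ((t + 1 : ℕ) : ℤ) < r v := h
        omega
    | succ t' =>
      obtain ⟨-, h1, -, h3⟩ := Config.compatible_succ h hvt
      push_cast at hvt
      -- A node reached before time `t + 1` relies on its own previous state; one reached exactly
      -- then relies on a predecessor of rank `t`.
      by_cases hle : r v ≤ t
      · obtain ⟨e1, e2⟩ := ih v v' t' hv h1 hle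
        exact ⟨by omega, e2⟩
      · have hg : v ≠ C.gen := by
          rintro rfl
          rw [hr.gen] at hle
          omega
        obtain ⟨d, hd, hrd⟩ := hr.pred v hv hg
        obtain ⟨e1, e2⟩ := ih _ _ t' hd (h3 d hd) (by omega)
        refine ⟨by omega, ?_⟩
        rw [← add_left_inj (dir d), e2]
        abel

/-! ### Comparing another configuration with the recognized one -/

/-- `C'` has a node in the place of `v`, and the event of being `v` at time `t` in `C` is compatible
with what that node has seen. -/
def Config.Fits (C : Config) (r : ℤ × ℤ → ℤ) (T : ℕ) (C' : Config) (v : ℤ × ℤ) (t : ℕ) : Prop :=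
  v - C.gen + C'.gen ∈ C'.cells ∧
    C.Compatible r T ((C.detector r T).st C' t (v - C.gen + C'.gen)) v t

theorem Config.Fits.bc_iff {C' : Config} {v : ℤ × ℤ} {t : ℕ} (h : C.Fits r T C' v t)
    (hv : r v ≤ t) (ht : 1 ≤ t) (d : Fin 4) :
    v - C.gen + C'.gen + dir d ∈ C'.cells ↔ v + dir d ∈ C.cells := by
  obtain ⟨t, rfl⟩ : ∃ k, t = k + 1 := ⟨t - 1, by omega⟩
  exact (Config.compatible_succ h.2 hv).2.2.1 d

/-- What a node has seen includes what its neighbours had seen one step earlier, so agreement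
propagates backwards in time. -/
theorem Config.Fits.prev {C' : Config} {v : ℤ × ℤ} {t : ℕ} (h : C.Fits r T C' v (t + 1))
    (hv : r v ≤ (t + 1 : ℕ)) (d : Fin 4) (hd : v + dir d ∈ C.cells) :
    C.Fits r T C' (v + dir d) t := by
  have h1 := (h.bc_iff hv (by omega) d).2 hd
  have h2 := (Config.compatible_succ h.2 hv).2.2.2 d hd
  rw [show v - C.gen + C'.gen + dir d = v + dir d - C.gen + C'.gen by abel] at h1 h2
  exact ⟨h1, h2⟩

/-- The rank bounds say that the nodes on the path are already reached; an unreached node carries no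
information about its surroundings. -/
theorem Config.Fits.segment {C' : Config} (d : Fin 4) (n : ℕ) : ∀ {v : ℤ × ℤ} {t : ℕ},
    C.Fits r T C' v (t + n) →
    (∀ k : ℕ, k < n → r (v + (k : ℤ) • dir d) ≤ t + n - k) →
    (∀ k : ℕ, 1 ≤ k → k ≤ n → v + (k : ℤ) • dir d ∈ C.cells) →
    C.Fits r T C' (v + (n : ℤ) • dir d) t := by
  induction n with
  | zero => intro v t h _ _; simpa using h
  | succ n ih =>
    intro v t h h1 h2
    have h3 : C.Fits r T C' (v + dir d) (t + n) :=
      Config.Fits.prev h (by have := h1 0 (by omega); simp at this ⊢; linarith) d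
        (by simpa using h2 1 le_rfl (by omega))
    have e (k : ℕ) : v + dir d + (k : ℤ) • dir d = v + ((k + 1 : ℕ) : ℤ) • dir d := by
      push_cast
      rw [add_smul, one_smul]
      abel
    have h4 := ih h3
      (fun k hk => by
        rw [e]
        have := h1 (k + 1) (by omega)
        push_cast at this ⊢
        linarith)
      (fun k hk hk' => by rw [e]; exact h2 (k + 1) (by omega) (by omega))
    rwa [e] at h4

/-- Premature firing is impossible because reached nodes know the time. -/
theorem Config.detector_firesAt (hr : C.IsRank r) (hT : ∀ v ∈ C.cells, r v ≤ T) :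
    (C.detector r T).FiresAt C T := by
  refine fun v hv => ⟨fun t ht hf => ?_, ?_, v, Config.compatible_detector_st hr T le_rfl v hv⟩
  · obtain ⟨hs, u, hu⟩ := hf
    have huC : u ∈ C.cells := by
      cases hst : (C.detector r T).st C t v with
      | none => exact absurd hst hs
      | some S =>
        rw [hst] at hu
        obtain ⟨h, -⟩ := hu
        exact (Finset.mem_product.1 h).1
    have := (Config.eq_of_compatible hr T u v t huC hu (hT u huC)).1
    omega
  · intro h
    have h1 := Config.compatible_detector_st hr T le_rfl v hv
    rw [h] at h1
    have h1 : (T : ℤ) < r v := h1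
    have := hT v hv
    omega

theorem Config.fits_of_mem_firing (hr : C.IsRank r) (hT : ∀ v ∈ C.cells, r v ≤ T)
    {C' : Config} {t : ℕ} {v' : ℤ × ℤ}
    (hv' : v' ∈ C'.cells) (hf : (C.detector r T).st C' t v' ∈ (C.detector r T).firing) :
    ∃ v ∈ C.cells, C.Fits r T C' v T := by
  obtain ⟨hs, u, hu⟩ := hf
  have huC : u ∈ C.cells := by
    cases hst : (C.detector r T).st C' t v' with
    | none => exact absurd hst hs
    | some S =>
      rw [hst] at hu
      obtain ⟨h, -⟩ := hu
      exact (Finset.mem_product.1 h).1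
  obtain ⟨rfl, rfl⟩ := Config.eq_of_compatible hr T u v' t huC hu (hT u huC)
  exact ⟨u, huC, hv', hu⟩

/-- If only `C` itself can look like `C` to a node of `C` at time `T`, then some solution
fires `C` at time `T`, unless `A` is faster. -/
theorem exists_solution_ft_eq {m : Model} {Γ : Set Config} {A : Automaton}
    (hA : IsSolution m Γ A) (hΓ : ∀ C' ∈ Γ, ∃ v ∈ C'.cells, v ≠ C'.gen)
    (hr : C.IsRank r) (hT : ∀ v ∈ C.cells, r v ≤ T) (hT0 : 0 < T)
    (hslow : ∀ t < T, ∀ v ∈ C.cells, A.st C t v ∉ A.firing)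
    (hfit : ∀ C' ∈ Γ, ∀ v ∈ C.cells, C.Fits r T C' v T → C' = C) :
    ∃ A' : Automaton, IsSolution m Γ A' ∧ A'.ft C = T := by
  have hD := C.detector_firesAt hr hT
  have hC : (A.join (C.detector r T)).FiresAt C T :=
    Automaton.join_firesAt hT0 (fun t ht v hv => ⟨hslow t ht v hv, (hD v hv).1 t ht⟩)
      fun v hv => .inr (hD v hv).2
  refine ⟨_, ⟨Automaton.join_inModel hA.1 ⟨_, fun _ => rfl⟩, fun C' hC' => ?_⟩, hC.ft_eq⟩
  by_cases hCC : C' = C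
  · exact ⟨T, hCC ▸ hC⟩
  · obtain ⟨T', hT'⟩ := hA.2 C' hC'
    obtain ⟨u, hu, hug⟩ := hΓ C' hC'
    -- A node other than the general starts quiescent, so `A` cannot fire `C'` at time 0.
    have h0 : T' ≠ 0 := by
      rintro rfl
      have := (hT' u hu).2
      simp only [Automaton.st, if_neg hug] at this
      exact A.quiescent_notMem_firing this
    refine ⟨T', Automaton.join_firesAt (by omega) (fun t ht v hv => ⟨(hT' v hv).1 t ht, fun h => ?_⟩)
      fun v hv => .inl (hT' v hv).2⟩
    obtain ⟨w, hw, hfw⟩ := Config.fits_of_mem_firing hr hT hv h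
    exact hCC (hfit C' hC' w hw hfw)

/-! ### Rectangular walls -/

theorem mem_rectWallCells {w h : ℕ} {x y : ℤ} : (x, y) ∈ rectWallCells w h ↔
    (0 ≤ x ∧ x ≤ w) ∧ (0 ≤ y ∧ y ≤ h) ∧ (x = 0 ∨ x = w ∨ y = 0 ∨ y = h) := by
  simp [rectWallCells, and_assoc]

theorem dir_zero : dir 0 = (1, 0) := rfl
theorem dir_one : dir 1 = (0, 1) := rfl
theorem dir_two : dir 2 = (-1, 0) := rfl
theorem dir_three : dir 3 = (0, -1) := rfl

/-- The wall with the general at the southwest corner. -/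
noncomputable def wall (w h : ℕ) : Config where
  cells := rectWallCells w h
  gen := (0, 0)
  gen_mem := mem_rectWallCells.2 (by omega)

/-- The distance of a node of the wall to the southwest corner. -/
def wallRank (p : ℤ × ℤ) : ℤ := p.1 + p.2

theorem isRank_wall {w h : ℕ} : (wall w h).IsRank wallRank where
  gen := rfl
  step := by
    rintro ⟨x, y⟩ - d -
    fin_cases d <;> simp [wallRank, dir] <;> omega
  pred := by
    rintro ⟨x, y⟩ hv hg
    replace hv := mem_rectWallCells.1 hv
    have hg : ¬ (x = 0 ∧ y = 0) := fun hxy => hg (Prod.ext hxy.1 hxy.2)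
    by_cases hy : 0 < x ∧ (y = 0 ∨ y = h)
    · refine ⟨2, ?_, ?_⟩
      · simp only [dir_two, Prod.mk_add_mk]
        exact mem_rectWallCells.2 (by omega)
      · simp only [wallRank, dir_two, Prod.mk_add_mk]
        omega
    · refine ⟨3, ?_, ?_⟩
      · simp only [dir_three, Prod.mk_add_mk]
        exact mem_rectWallCells.2 (by omega)
      · simp only [wallRank, dir_three, Prod.mk_add_mk]
        omega
  nonneg := by
    rintro ⟨x, y⟩ hv
    replace hv := mem_rectWallCells.1 hv
    simp only [wallRank]
    omega

theorem wallRank_le {w h : ℕ} : ∀ v ∈ (wall w h).cells, wallRank v ≤ (w + h : ℕ) := by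
  rintro ⟨x, y⟩ hv
  replace hv := mem_rectWallCells.1 hv
  simp only [wallRank]
  omega

/-! ### What a node of a wall has learned at a given time -/

section Fits

variable {w h w' h' : ℕ} {T : ℕ} {C' : Config}

/-- Towards the southwest corner, rank and remaining time drop together, so a bound at the start
suffices. In `fits_east` and `fits_north` the rank grows, and the bound is needed at the end. -/
theorem fits_west {x y : ℤ} {t n : ℕ} (hf : (wall w h).Fits wallRank T C' (x, y) (t + n))
    (hle : x + y ≤ t + n) (hy : y = 0 ∨ y = h) (hn : n ≤ x) (hx : x ≤ w) :
    (wall w h).Fits wallRank T C' (x - n, y) t := by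
  have := Config.Fits.segment 2 n hf (fun k hk => ?_) fun k hk hk' => ?_
  · simpa [dir_two, sub_eq_add_neg] using this
  · simp [wallRank, dir_two]
    omega
  · simp only [dir_two, Prod.smul_mk, Prod.mk_add_mk, smul_eq_mul]
    exact mem_rectWallCells.2 (by omega)

theorem fits_south {x y : ℤ} {t n : ℕ} (hf : (wall w h).Fits wallRank T C' (x, y) (t + n))
    (hle : x + y ≤ t + n) (hx : x = 0 ∨ x = w) (hn : n ≤ y) (hy : y ≤ h) :
    (wall w h).Fits wallRank T C' (x, y - n) t := by
  have := Config.Fits.segment 3 n hf (fun k hk => ?_) fun k hk hk' => ?_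
  · simpa [dir_three, sub_eq_add_neg] using this
  · simp [wallRank, dir_three]
    omega
  · simp only [dir_three, Prod.smul_mk, Prod.mk_add_mk, smul_eq_mul]
    exact mem_rectWallCells.2 (by omega)

theorem fits_east {x : ℤ} {t n : ℕ} (hf : (wall w h).Fits wallRank T C' (x, 0) (t + n))
    (hle : x + n ≤ t) (hx : 0 ≤ x) (hn : x + n ≤ w) :
    (wall w h).Fits wallRank T C' (x + n, 0) t := by
  have := Config.Fits.segment 0 n hf (fun k hk => ?_) fun k hk hk' => ?_
  · simpa [dir_zero] using this
  · simp [wallRank, dir_zero]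
    omega
  · simp only [dir_zero, Prod.smul_mk, Prod.mk_add_mk, smul_eq_mul]
    exact mem_rectWallCells.2 (by omega)

theorem fits_north {y : ℤ} {t n : ℕ} (hf : (wall w h).Fits wallRank T C' (0, y) (t + n))
    (hle : y + n ≤ t) (hy : 0 ≤ y) (hn : y + n ≤ h) :
    (wall w h).Fits wallRank T C' (0, y + n) t := by
  have := Config.Fits.segment 1 n hf (fun k hk => ?_) fun k hk hk' => ?_
  · simpa [dir_one] using this
  · simp [wallRank, dir_one]
    omega
  · simp only [dir_one, Prod.smul_mk, Prod.mk_add_mk, smul_eq_mul]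
    exact mem_rectWallCells.2 (by omega)

theorem Config.Fits.mem_wall_iff (hC : C'.cells = rectWallCells w' h') {x y : ℤ} {t : ℕ}
    (hf : (wall w h).Fits wallRank T C' (x, y) t) (hle : x + y ≤ t) (ht : 1 ≤ t) :
    (x + C'.gen.1, y + C'.gen.2) ∈ rectWallCells w' h' ∧
    ((x + C'.gen.1 + 1, y + C'.gen.2) ∈ rectWallCells w' h' ↔ (x + 1, y) ∈ rectWallCells w h) ∧
    ((x + C'.gen.1, y + C'.gen.2 + 1) ∈ rectWallCells w' h' ↔ (x, y + 1) ∈ rectWallCells w h) ∧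
    ((x + C'.gen.1 - 1, y + C'.gen.2) ∈ rectWallCells w' h' ↔ (x - 1, y) ∈ rectWallCells w h) ∧
    ((x + C'.gen.1, y + C'.gen.2 - 1) ∈ rectWallCells w' h' ↔ (x, y - 1) ∈ rectWallCells w h) := by
  have e : ((x, y) : ℤ × ℤ) - (wall w h).gen + C'.gen = (x + C'.gen.1, y + C'.gen.2) := by
    ext <;> simp [wall]
  have h0 := hf.1
  have h1 := hf.bc_iff hle ht
  rw [e, hC] at h0
  simp only [e, hC] at h1
  simp only [wall] at h1
  refine ⟨h0, ?_, ?_, ?_, ?_⟩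
  · simpa [dir_zero] using h1 0
  · simpa [dir_one] using h1 1
  · simpa [dir_two, sub_eq_add_neg] using h1 2
  · simpa [dir_three, sub_eq_add_neg] using h1 3


/-- Only the southwest corner of a wall has just its east and north neighbours. Boundary conditions
are seen from time 1 on. -/
theorem gen_eq_of_fits_southwest (hw : 2 ≤ w) (hh : 2 ≤ h)
    (hC : C'.cells = rectWallCells w' h') {t : ℕ} (ht : 1 ≤ t)
    (hf : (wall w h).Fits wallRank T C' (0, 0) t) : C'.gen = (0, 0) := by
  have := Config.Fits.mem_wall_iff hC hf (by omega) ht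
  simp only [mem_rectWallCells] at this
  ext
  · show C'.gen.1 = 0
    omega
  · show C'.gen.2 = 0
    omega

theorem gen_add_eq_of_fits_southeast (hw : 2 ≤ w) (hh : 2 ≤ h) (hh' : 2 ≤ h')
    (hC : C'.cells = rectWallCells w' h') {t : ℕ} (ht : w ≤ t)
    (hf : (wall w h).Fits wallRank T C' (w, 0) t) : w + C'.gen.1 = w' ∧ C'.gen.2 = 0 := by
  have := Config.Fits.mem_wall_iff hC hf (by omega) (by omega)
  simp only [mem_rectWallCells] at this
  omega

theorem gen_add_eq_of_fits_northwest (hw : 2 ≤ w) (hh : 2 ≤ h) (hw' : 2 ≤ w')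
    (hC : C'.cells = rectWallCells w' h') {t : ℕ} (ht : h ≤ t)
    (hf : (wall w h).Fits wallRank T C' (0, h) t) : C'.gen.1 = 0 ∧ h + C'.gen.2 = h' := by
  have := Config.Fits.mem_wall_iff hC hf (by omega) (by omega)
  simp only [mem_rectWallCells] at this
  omega

theorem gen_add_eq_of_fits_northeast (hw : 2 ≤ w) (hh : 2 ≤ h) (hw' : 2 ≤ w') (hh' : 2 ≤ h')
    (hC : C'.cells = rectWallCells w' h') {t : ℕ} (ht : w + h ≤ t)
    (hf : (wall w h).Fits wallRank T C' (w, h) t) : w + C'.gen.1 = w' ∧ h + C'.gen.2 = h' := by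
  have := Config.Fits.mem_wall_iff hC hf (by omega) (by omega)
  simp only [mem_rectWallCells] at this
  omega

/-- At time `w + h` every node of the wall knows one side of the wall and the position of the
general, or knows one side and is the last node to be reached. -/
theorem side_eq_of_fits (hw : 2 ≤ w) (hh : 2 ≤ h) (hw' : 2 ≤ w') (hh' : 2 ≤ h')
    (hC : C'.cells = rectWallCells w' h') {v : ℤ × ℤ} (hv : v ∈ (wall w h).cells)
    (hf : (wall w h).Fits wallRank T C' v (w + h)) :
    (w = w' ∨ h = h') ∧ (C'.gen.1 = w' - w ∧ C'.gen.2 = h' - h ∨ C'.gen = (0, 0)) := by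
  obtain ⟨x, y⟩ := v
  have hv := mem_rectWallCells.1 hv
  lift x to ℕ using hv.1.1
  lift y to ℕ using hv.2.1.1
  have hSW (t : ℕ) (ht : 1 ≤ t) (hf : (wall w h).Fits wallRank T C' (0, 0) t) :=
    gen_eq_of_fits_southwest hw hh hC ht hf
  have hSE (t : ℕ) (ht : w ≤ t) (hf : (wall w h).Fits wallRank T C' (w, 0) t) :=
    gen_add_eq_of_fits_southeast hw hh hh' hC ht hf
  have hNW (t : ℕ) (ht : h ≤ t) (hf : (wall w h).Fits wallRank T C' (0, h) t) :=
    gen_add_eq_of_fits_northwest hw hh hw' hC ht hf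
  -- The far corner cannot yet know the boundary condition of the general. It recognizes itself as a
  -- northeast corner and sees the southeast corner as it was at time `w`; together these give `h =
  -- h'`.
  by_cases hlast : x = w ∧ y = h
  · obtain ⟨rfl, rfl⟩ := hlast
    have h1 := gen_add_eq_of_fits_northeast hw hh hw' hh' hC le_rfl hf
    have h2 := hSE x le_rfl (by simpa using fits_south hf (by simp) (.inr rfl) le_rfl le_rfl)
    omega
  have hx := hv.2.2
  rcases (by omega : y = 0 ∨ x = w ∧ y < h ∨ x = 0 ∨ y = h ∧ x < w) with
    rfl | ⟨rfl, hy⟩ | rfl | ⟨rfl, hx⟩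
  · rw [show w + h = w + h - x + x by omega] at hf
    have h1 : (wall w h).Fits wallRank T C' (0, 0) (w + h - x) := by
      simpa using fits_west hf (by omega) (.inl rfl) le_rfl (by omega)
    have h2 := hSW _ (by omega) h1
    refine ⟨?_, .inr h2⟩
    -- News of the southeast corner reaches `(x, 0)` at time `w + (w - x)`, news of the northwest
    -- corner at `h + h + x`; one of these is at most `w + h`.
    by_cases hle : w ≤ h + x
    · rw [show w + h - x + x = h + x + (w - x) by omega] at hf
      have h3 := fits_east hf (by omega) (by omega) (by omega)
      rw [show (x : ℤ) + (w - x : ℕ) = w by omega] at h3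
      have := hSE _ hle h3
      rw [h2] at this
      left
      simpa using this.1
    · rw [show w + h - x = w - x + h by omega] at h1
      have h3 := fits_north h1 (by omega) le_rfl (by omega)
      rw [zero_add] at h3
      have := hNW _ (by omega) h3
      rw [h2] at this
      right
      simpa using this.2
  · rw [show x + h = x + h - y + y by omega] at hf
    have h1 : (wall x h).Fits wallRank T C' (x, 0) (x + h - y) := by
      simpa using fits_south hf (by omega) (.inr rfl) le_rfl (by omega)
    have h3 := hSE _ (by omega) h1
    rw [show x + h - y = h - y + x by omega] at h1
    -- Being strictly below the far corner leaves `h - y ≥ 1` steps for the general to see its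
    -- surroundings.
    have h2 := hSW (h - y) (by omega)
      (by simpa using fits_west h1 (by omega) (.inl rfl) le_rfl le_rfl)
    refine ⟨.inl ?_, .inr h2⟩
    rw [h2] at h3
    simpa using h3.1
  · rw [show w + h = w + h - y + y by omega] at hf
    have h1 : (wall w h).Fits wallRank T C' (0, 0) (w + h - y) := by
      simpa using fits_south hf (by omega) (.inl rfl) le_rfl (by omega)
    have h2 := hSW _ (by omega) h1
    refine ⟨?_, .inr h2⟩
    by_cases hle : h ≤ w + y
    · rw [show w + h - y + y = w + y + (h - y) by omega] at hf
      have h3 := fits_north hf (by omega) (by omega) (by omega)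
      rw [show (y : ℤ) + (h - y : ℕ) = h by omega] at h3
      have := hNW _ hle h3
      rw [h2] at this
      right
      simpa using this.2
    · rw [show w + h - y = h - y + w by omega] at h1
      have h3 := fits_east h1 (by omega) le_rfl (by omega)
      rw [zero_add] at h3
      have := hSE _ (by omega) h3
      rw [h2] at this
      left
      simpa using this.1
  · rw [show w + y = w + y - x + x by omega] at hf
    have h1 : (wall w y).Fits wallRank T C' (0, y) (w + y - x) := by
      simpa using fits_west hf (by omega) (.inr rfl) le_rfl (by omega)
    have h3 := hNW _ (by omega) h1
    rw [show w + y - x = w - x + y by omega] at h1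
    have h2 := hSW (w - x) (by omega)
      (by simpa using fits_south h1 (by omega) (.inl rfl) le_rfl le_rfl)
    refine ⟨.inr ?_, .inr h2⟩
    rw [h2] at h3
    simpa using h3.2

end Fits

/-! ### The pigeonhole argument and the contradiction -/

/-- No automaton fires a long wall at the very moment when the far corner is reached. -/
theorem not_firesAt_wall (A : Automaton) [Fintype A.State] {w h : ℕ} (hw : 2 ≤ w)
    (hh : Fintype.card (A.State × A.State) + 2 ≤ h) : ¬ A.FiresAt (wall w h) (w + h) := by
  intro hf
  have hr := isRank_wall (w := w) (h := h)
  -- The node `(w, k + 1)` is reached at time `w + (k + 1)`; the pair holds its states then and one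
  -- step later.
  let p (k : ℕ) : A.State × A.State :=
    (A.st (wall w h) (w + (k + 1)) (w, (k + 1 : ℕ)), A.st (wall w h) (w + (k + 2)) (w, (k + 1 : ℕ)))
  let inp (s : A.State) : Fin 4 → Option A.State := ![none, some A.quiescent, none, some s]
  let f (s : A.State × A.State) : A.State × A.State :=
    (A.next A.quiescent (inp s.1), A.next (A.next A.quiescent (inp s.1)) (inp s.2))
  have hquiet (t : ℕ) (y : ℤ) (hy : 0 ≤ y) (hyh : y ≤ h) (hty : (t : ℤ) < w + y) :
      A.st (wall w h) t (w, y) = A.quiescent :=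
    A.st_eq_quiescent hr t _ (mem_rectWallCells.2 (by omega)) (by simpa [wallRank] using hty)
  -- The north neighbour `(w, k + 3)` exists as `k + 3 ≤ h`, and is still quiescent before time `w +
  -- (k + 3)`.
  have hstep (t k : ℕ) (hk : k + 3 ≤ h) (ht : t < w + (k + 3)) :
      A.st (wall w h) (t + 1) (w, (k + 2 : ℕ)) =
        A.next (A.st (wall w h) t (w, (k + 2 : ℕ))) (inp (A.st (wall w h) t (w, (k + 1 : ℕ)))) := by
    simp only [Automaton.st]
    congr 1
    funext d
    have m0 : ((w : ℤ) + 1, ((k + 2 : ℕ) : ℤ)) ∉ (wall w h).cells := fun hm => by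
      have := mem_rectWallCells.1 hm; omega
    have m1 : ((w : ℤ), ((k + 2 : ℕ) : ℤ) + 1) ∈ (wall w h).cells := mem_rectWallCells.2 (by omega)
    have m2 : ((w : ℤ) - 1, ((k + 2 : ℕ) : ℤ)) ∉ (wall w h).cells := fun hm => by
      have := mem_rectWallCells.1 hm; omega
    have m3 : ((w : ℤ), ((k + 1 : ℕ) : ℤ)) ∈ (wall w h).cells := mem_rectWallCells.2 (by omega)
    have e3 : ((w : ℤ), ((k + 2 : ℕ) : ℤ)) + dir 3 = ((w : ℤ), ((k + 1 : ℕ) : ℤ)) := by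
      simp [dir_three]; ring
    have e2 : ((w : ℤ), ((k + 2 : ℕ) : ℤ)) + dir 2 = ((w : ℤ) - 1, ((k + 2 : ℕ) : ℤ)) := by
      simp [dir_two]; ring
    have e1 : ((w : ℤ), ((k + 2 : ℕ) : ℤ)) + dir 1 = ((w : ℤ), ((k + 2 : ℕ) : ℤ) + 1) := by
      simp [dir_one]
    have e0 : ((w : ℤ), ((k + 2 : ℕ) : ℤ)) + dir 0 = ((w : ℤ) + 1, ((k + 2 : ℕ) : ℤ)) := by
      simp [dir_zero]
    match d with
    | 0 => rw [e0, if_neg m0]; rfl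
    | 1 =>
      rw [e1, if_pos m1, hquiet t _ (by omega) (by omega) (by push_cast; omega)]
      rfl
    | 2 => rw [e2, if_neg m2]; rfl
    | 3 => rw [e3, if_pos m3]; rfl
  have hp (k : ℕ) (hk : k + 3 ≤ h) : p (k + 1) = f (p k) := by
    have h1 := hstep (w + (k + 1)) k hk (by omega)
    rw [hquiet (w + (k + 1)) (k + 2 : ℕ) (by omega) (by omega) (by push_cast; omega)] at h1
    have h2 := hstep (w + (k + 2)) k hk (by omega)
    rw [show w + (k + 2) = w + (k + 1) + 1 by omega, h1] at h2
    exact Prod.ext h1 h2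
  have hiter (j k : ℕ) (hk : k + j + 2 ≤ h) : p (k + j) = f^[j] (p k) := by
    induction j with
    | zero => rfl
    | succ j ih =>
      rw [Function.iterate_succ_apply', ← ih (by omega), ← hp _ (by omega), add_assoc]
  obtain ⟨i, j, hij, he⟩ := Fintype.exists_ne_map_eq_of_card_lt
    (fun i : Fin (Fintype.card (A.State × A.State) + 1) => p i) (by simp)
  wlog hlt : i < j generalizing i j
  · exact this j i hij.symm he.symm (lt_of_le_of_ne (not_lt.1 hlt) hij.symm)
  have hlt : (i : ℕ) < j := hlt
  have hj : (j : ℕ) ≤ h - 2 := by have := j.2; omega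
  -- The coincidence is shifted up the side until the later index is `h - 2`, that is, the node `(w,
  -- h - 1)` observed at time `w + h`.
  have h1 := hiter (h - 2 - j) i (by omega)
  have h2 := hiter (h - 2 - j) j (by omega)
  rw [show p i = p j from he, ← h2] at h1
  have h3 : A.st (wall w h) (w + h) (w, (h - 2 + 1 : ℕ)) ∈ A.firing :=
    (hf _ (mem_rectWallCells.2 (by omega))).2
  have h4 : A.st (wall w h) (w + (i + (h - 2 - j) + 2)) (w, (i + (h - 2 - j) + 1 : ℕ)) ∉ A.firing :=
    (hf _ (mem_rectWallCells.2 (by omega))).1 _ (by omega)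
  apply h4
  have h5 := congrArg Prod.snd h1
  rw [show (j : ℕ) + (h - 2 - j) = h - 2 by omega] at h5
  have h6 : A.st (wall w h) (w + (i + (h - 2 - j) + 2)) (w, (i + (h - 2 - j) + 1 : ℕ)) =
    A.st (wall w h) (w + (h - 2 + 2)) (w, (h - 2 + 1 : ℕ)) := h5
  rwa [h6, show h - 2 + 2 = h by omega]

theorem le_of_firesAt_wall {A : Automaton} {w h T : ℕ}
    (hf : A.FiresAt (wall w h) T) : w + h ≤ T := by
  by_contra! hlt
  have hm : ((w : ℤ), (h : ℤ)) ∈ (wall w h).cells := mem_rectWallCells.2 (by omega)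
  have h1 := (hf _ hm).2
  rw [A.st_eq_quiescent isRank_wall T _ hm (by simp [wallRank]; omega)] at h1
  exact A.quiescent_notMem_firing h1

/-- Bounding `Γ` from both sides treats the two variations at once: competitors may have the general
anywhere, while the wall being recognized has it at the corner. -/
theorem not_isMinimalTimeSolution {m : Model} {a b : ℕ} (ha : 1 ≤ a) (hb : 1 ≤ b) {Γ : Set Config}
    (hΓ : Γ ⊆ gRectWall a b) (hwall : ∀ l, 2 ≤ l → wall (a * l) (b * l) ∈ Γ) (A : Automaton) :
    ¬ IsMinimalTimeSolution m Γ A := by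
  rintro ⟨hA, hmin⟩
  have := A.finite_state
  have := Fintype.ofFinite A.State
  set l := Fintype.card (A.State × A.State) + 2
  have hla : l ≤ a * l := Nat.le_mul_of_pos_left l ha
  have hlb : l ≤ b * l := Nat.le_mul_of_pos_left l hb
  have hCΓ := hwall l (by omega)
  obtain ⟨T, hT⟩ := hA.2 _ hCΓ
  have hle := le_of_firesAt_wall hT
  suffices ∃ A', IsSolution m Γ A' ∧ A'.ft (wall (a * l) (b * l)) = a * l + b * l by
    have h1 : mft m Γ (wall (a * l) (b * l)) ≤ a * l + b * l := Nat.sInf_le this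
    rw [← hmin _ hCΓ, hT.ft_eq] at h1
    obtain rfl : T = a * l + b * l := by omega
    exact not_firesAt_wall A (by omega) (by omega) hT
  refine exists_solution_ft_eq hA (fun C' hC' => ?_)
    isRank_wall wallRank_le (by omega)
    (fun t ht v hv => (hT v hv).1 t (by omega)) fun C' hC' v hv hf => ?_
  · obtain ⟨k, hk, hC⟩ := hΓ hC'
    have hka : k ≤ a * k := Nat.le_mul_of_pos_left k ha
    by_cases hg : C'.gen = (0, 0)
    · exact ⟨((a * k : ℕ), 0), hC ▸ mem_rectWallCells.2 (by omega), by simp [hg]; omega⟩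
    · exact ⟨(0, 0), hC ▸ mem_rectWallCells.2 (by omega), fun h => hg h.symm⟩
  · obtain ⟨k, hk, hC⟩ := hΓ hC'
    have hka : k ≤ a * k := Nat.le_mul_of_pos_left k ha
    have hkb : k ≤ b * k := Nat.le_mul_of_pos_left k hb
    obtain ⟨h1, h2⟩ := side_eq_of_fits (by omega) (by omega) (by omega) (by omega) hC hv hf
    -- One known side determines the scale because the ratio of the sides is fixed.
    obtain rfl : l = k := by
      rcases h1 with h1 | h1
      · exact Nat.eq_of_mul_eq_mul_left ha h1
      · exact Nat.eq_of_mul_eq_mul_left hb h1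
    have hg : C'.gen = (0, 0) := by
      rcases h2 with h2 | h2
      · exact Prod.ext (by simpa using h2.1) (by simpa using h2.2)
      · exact h2
    obtain ⟨cells, gen, hmem⟩ := C'
    subst hC hg
    rfl

end FSSP

theorem mainTheorem2 (m : FSSP.Model) (a b : ℕ) (ha : 1 ≤ a) (hb : 1 ≤ b) :
    (¬ ∃ A : FSSP.Automaton, FSSP.IsMinimalTimeSolution m (FSSP.rectWall a b) A) ∧
    (¬ ∃ A : FSSP.Automaton, FSSP.IsMinimalTimeSolution m (FSSP.gRectWall a b) A) :=
  ⟨fun ⟨A, hA⟩ => FSSP.not_isMinimalTimeSolution (Γ := FSSP.rectWall a b) ha hb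
      (fun _ ⟨l, hl, hC, _⟩ => ⟨l, hl, hC⟩) (fun l hl => ⟨l, hl, rfl, rfl⟩) A hA,
    fun ⟨A, hA⟩ => FSSP.not_isMinimalTimeSolution ha hb
      (fun _ hC => hC) (fun l hl => ⟨l, hl, rfl⟩) A hA⟩
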